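/- For $k\ge 1$ let $f_k=\prod_{m\ge1}(1-q^{km})\in\mathbb Z[[q]]$, and let $a_3(n)$, the number of 3-regular cubic partitions of $n$, be defined by the generating function $$\sum_{n\ge0}a_3(n)q^n=\frac{f_3f_6}{f_1f_2}.$$ Define integers $m_{i,j}$ ($i,j\ge1$) as follows: the first three rows are $$(m_{1,j})_{j\ge1}=(3,0,0,\dots),\qquad (m_{2,j})_{j\ge1}=(2,3^3,0,0,\dots),\qquad (m_{3,j})_{j\ge1}=(1,3^3,3^5,0,0,\dots),$$ and for $i\ge4$, $m_{i,1}=0$ and $m_{i,j}=9m_{i-1,j-1}+3m_{i-2,j-1}+m_{i-3,j-1}$ for $j\ge2$. Let $A=(a_{i,j})_{i,j\ge1}$ and $B=(b_{i,j})_{i,j\ge1}$ be the infinite matrices with $$a_{i,j}=m_{4i-3,\,i+j-1},\qquad b_{i,j}=m_{4i-1,\,i+j-1};$$ each of their columns has only finitely many non-zero entries. Define row vectors $\mathbf x_\alpha=(x_{\alpha,1},x_{\alpha,2},\dots)$, $\alpha\ge0$, by $\mathbf x_0=(1,0,0,\dots)$ and $$\mathbf x_{\alpha+1}=\mathbf x_\alpha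 A\ \text{ if }\alpha\text{ is even},\qquad \mathbf x_{\alpha+1}=\mathbf x_\alpha B\ \text{ if }\alpha\text{ is odd}.$$ Then for every integer $\alpha\ge0$, as formal power series in $q$, $$\sum_{n\ge0}a_3\left(3^{2\alpha}n+\frac{3^{2\alpha}-1}{4}\right)q^n=\sum_{i\ge1}x_{2\alpha,i}\,q^{i-1}\left(\frac{f_3f_6}{f_1f_2}\right)^{4i-3}$$ and $$\sum_{n\ge0}a_3\left(3^{2\alpha+1}n+\frac{3^{2\alpha+2}-1}{4}\right)q^n=\sum_{i\ge1}x_{2\alpha+1,i}\,q^{i-1}\left(\frac{f_3f_6}{f_1f_2}\right)^{4i-1}.$$ -/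

import Mathlib

open PowerSeries
open scoped PowerSeries.WithPiTopology

noncomputable section

namespace CubicPartition

/-- `f k = ∏_{m ≥ 1} (1 - q^{k m})` as a formal power series in `q = X` over `ℤ`; the product
converges coefficientwise for `k ≥ 1`, see `multipliable_f`. -/
def f (k : ℕ) : ℤ⟦X⟧ := ∏' m : ℕ, (1 - X ^ (k * (m + 1)))

theorem multipliable_f {k : ℕ} (hk : 0 < k) :
    Multipliable (fun m : ℕ => (1 - X ^ (k * (m + 1)) : ℤ⟦X⟧)) := by
  simp_rw [sub_eq_add_neg]
  refine PowerSeries.WithPiTopology.multipliable_one_add_of_tendsto_order_atTop_nhds_top ℤ ?_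
  refine ENat.tendsto_nhds_top_iff_natCast_lt.mpr fun n => Filter.eventually_atTop.mpr ⟨n, ?_⟩
  intro m hm
  rw [order_neg, order_X_pow]
  exact_mod_cast Nat.lt_of_lt_of_le (Nat.lt_succ_of_le hm) (Nat.le_mul_of_pos_left _ hk)

theorem constantCoeff_f {k : ℕ} (hk : 0 < k) : constantCoeff (f k) = 1 := by
  have h := (multipliable_f hk).map_tprod (PowerSeries.constantCoeff (R := ℤ))
    (PowerSeries.WithPiTopology.continuous_constantCoeff ℤ)
  rw [f, h]
  have : ∀ m : ℕ, constantCoeff (1 - X ^ (k * (m + 1)) : ℤ⟦X⟧) = 1 := by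
    intro m
    simp [hk.ne']
  simp [this]

/-- The quotient `f₃ f₆ / (f₁ f₂)`; the denominator has constant term `1`, and `invOfUnit _ 1`
is its inverse in `ℤ⟦X⟧`, see `quot_mul`. -/
def quot : ℤ⟦X⟧ := f 3 * f 6 * invOfUnit (f 1 * f 2) 1

theorem quot_mul : quot * (f 1 * f 2) = f 3 * f 6 := by
  rw [quot, mul_assoc, invOfUnit_mul, mul_one]
  simp [constantCoeff_f]

/-- `a₃(n)`, the number of 3-regular cubic partitions of `n`: the coefficients of
`∑ a₃(n) q^n = f₃ f₆ / (f₁ f₂)`. -/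
def a₃ (n : ℕ) : ℤ := coeff n quot

/-- The entries `m_{i,j}`, for `i, j ≥ 1` (and `0` if an index is `0`): the first three rows are
`(3,0,0,…)`, `(2,3³,0,…)`, `(1,3³,3⁵,0,…)`; for `i ≥ 4`, `m_{i,1} = 0` and, for `j ≥ 2`,
`m_{i,j} = 9 m_{i-1,j-1} + 3 m_{i-2,j-1} + m_{i-3,j-1}`. -/
def m : ℕ → ℕ → ℤ
  | 1, 1 => 3
  | 2, 1 => 2
  | 2, 2 => 3 ^ 3
  | 3, 1 => 1
  | 3, 2 => 3 ^ 3
  | 3, 3 => 3 ^ 5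
  | i + 4, j + 2 => 9 * m (i + 3) (j + 1) + 3 * m (i + 2) (j + 1) + m (i + 1) (j + 1)
  | _, _ => 0

/-- `A = (a_{i,j})` with `a_{i,j} = m_{4i-3,i+j-1}`. -/
def A : Matrix ℕ+ ℕ+ ℤ := Matrix.of fun i j => m (4 * (i : ℕ) - 3) ((i : ℕ) + (j : ℕ) - 1)

/-- `B = (b_{i,j})` with `b_{i,j} = m_{4i-1,i+j-1}`. -/
def B : Matrix ℕ+ ℕ+ ℤ := Matrix.of fun i j => m (4 * (i : ℕ) - 1) ((i : ℕ) + (j : ℕ) - 1)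

theorem m_eq_zero (i j : ℕ) (h : 3 * j < i) : m i j = 0 := by
  induction i using Nat.strong_induction_on generalizing j with
  | _ i ih =>
    match i, j with
    | 1, 0 | 2, 0 | 3, 0 | i + 4, 0 | i + 4, 1 => simp [m]
    | i + 4, j + 2 =>
      rw [m, ih (i + 3) (by omega) (j + 1) (by omega), ih (i + 2) (by omega) (j + 1) (by omega),
        ih (i + 1) (by omega) (j + 1) (by omega)]
      simp
    | 1, j + 1 | 2, j + 1 | 3, j + 1 => omega

/-- The product `v M` of an infinite row vector and an infinite matrix,
`(v M)_j = ∑_{i ≥ 1} v_i M_{i,j}`. It is used only for the matrices `A` and `B`, whose columns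
have finitely many non-zero entries (`finite_col_A`, `finite_col_B`). -/
def rowMul (v : ℕ+ → ℤ) (M : Matrix ℕ+ ℕ+ ℤ) : ℕ+ → ℤ := fun j => ∑ᶠ i : ℕ+, v i * M i j

theorem finite_col_A (j : ℕ+) : {i : ℕ+ | A i j ≠ 0}.Finite := by
  refine (Set.finite_Iic (3 * j)).subset fun i hi => ?_
  by_contra hlt
  have h' : 3 * (j : ℕ) < (i : ℕ) := by
    have := not_le.mp (fun h => hlt (Set.mem_Iic.mpr h))
    exact_mod_cast this
  exact hi (m_eq_zero _ _ (by have := j.pos; omega))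

theorem finite_col_B (j : ℕ+) : {i : ℕ+ | B i j ≠ 0}.Finite := by
  refine (Set.finite_Iic (3 * j)).subset fun i hi => ?_
  by_contra hlt
  have h' : 3 * (j : ℕ) < (i : ℕ) := by
    have := not_le.mp (fun h => hlt (Set.mem_Iic.mpr h))
    exact_mod_cast this
  exact hi (m_eq_zero _ _ (by have := j.pos; omega))

/-- The coefficient vectors `x_α`: `x_0 = (1,0,0,…)`, `x_{α+1} = x_α A` for even `α` and
`x_{α+1} = x_α B` for odd `α`. -/
def x : ℕ → ℕ+ → ℤ
  | 0 => fun i => if i = 1 then 1 else 0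
  | α + 1 => if Even α then rowMul (x α) A else rowMul (x α) B

end CubicPartition

end

namespace CubicPartition

section QBinomial

variable {R : Type*} [CommRing R]

/-- The Gaussian binomial coefficient in the base `p`. -/
def qBinom (p : R) : ℕ → ℕ → R
  | _, 0 => 1
  | 0, _ + 1 => 0
  | n + 1, k + 1 => qBinom p n k + p ^ (k + 1) * qBinom p n (k + 1)

theorem qBinom_zero_right (p : R) (n : ℕ) : qBinom p n 0 = 1 := by
  cases n <;> rfl

theorem qBinom_succ_succ (p : R) (n k : ℕ) :
    qBinom p (n + 1) (k + 1) = qBinom p n k + p ^ (k + 1) * qBinom p n (k + 1) := rfl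

theorem qBinom_eq_zero (p : R) {n k : ℕ} (h : n < k) : qBinom p n k = 0 := by
  induction n generalizing k with
  | zero => obtain ⟨k, rfl⟩ := Nat.exists_eq_succ_of_ne_zero h.ne'; rfl
  | succ n ih =>
    obtain ⟨k, rfl⟩ := Nat.exists_eq_succ_of_ne_zero (Nat.ne_of_gt (Nat.zero_lt_of_lt h))
    rw [Nat.succ_eq_add_one, qBinom_succ_succ, ih (by omega), ih (by omega)]
    simp

theorem prod_add_mul_pow (p x y : R) (n : ℕ) :
    ∏ i ∈ Finset.range n, (y + x * p ^ i) =
      ∑ k ∈ Finset.range (n + 1), qBinom p n k * p ^ (k.choose 2) * x ^ k * y ^ (n - k) := by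
  induction n generalizing x with
  | zero => simp [qBinom_zero_right]
  | succ n ih =>
    have h1 : ∏ i ∈ Finset.range n, (y + x * p ^ (i + 1)) =
        ∏ i ∈ Finset.range n, (y + (x * p) * p ^ i) :=
      Finset.prod_congr rfl fun i _ => by ring
    rw [Finset.prod_range_succ', h1, ih, Finset.sum_range_succ' _ (n + 1), pow_zero, mul_one,
      mul_add]
    have h2 : (∑ k ∈ Finset.range (n + 1),
          qBinom p n k * p ^ (k.choose 2) * (x * p) ^ k * y ^ (n - k)) * y =
        (∑ k ∈ Finset.range (n + 1),
          qBinom p n (k + 1) * p ^ ((k + 1).choose 2) * (x * p) ^ (k + 1) * y ^ (n - k)) +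
          y ^ (n + 1) := by
      rw [Finset.sum_range_succ', Finset.sum_range_succ, qBinom_eq_zero p (Nat.lt_succ_self n),
        add_mul, Finset.sum_mul]
      simp only [zero_mul, add_zero, qBinom_zero_right, Nat.choose_zero_succ, pow_zero,
        Nat.sub_zero, one_mul, ← pow_succ]
      congr 1
      refine Finset.sum_congr rfl fun k hk => ?_
      have : n - k = n - (k + 1) + 1 := by have := Finset.mem_range.mp hk; omega
      rw [this]
      ring
    rw [h2, add_right_comm, Finset.sum_mul, ← Finset.sum_add_distrib]
    simp only [qBinom_zero_right, Nat.choose_zero_succ, pow_zero, Nat.sub_zero, one_mul, mul_one]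
    congr 1
    refine Finset.sum_congr rfl fun k hk => ?_
    rw [qBinom_succ_succ, Nat.add_sub_add_right, Nat.choose_succ_succ' k 1, Nat.choose_one_right]
    ring

theorem qBinom_mul_prod_mul_prod (p : R) (k l : ℕ) :
    qBinom p (k + l) k * (∏ i ∈ Finset.range k, (1 - p ^ (i + 1))) *
      (∏ i ∈ Finset.range l, (1 - p ^ (i + 1))) =
      ∏ i ∈ Finset.range (k + l), (1 - p ^ (i + 1)) := by
  induction h : k + l generalizing k l with
  | zero =>
    obtain ⟨rfl, rfl⟩ := Nat.add_eq_zero_iff.mp h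
    simp [qBinom_zero_right]
  | succ n ih =>
    match k, l, h with
    | 0, l, h => simp [qBinom_zero_right, show l = n + 1 by omega]
    | k + 1, 0, h =>
      obtain rfl : k = n := by omega
      have := ih k 0 rfl
      rw [qBinom_succ_succ, qBinom_eq_zero p (Nat.lt_succ_self k), Finset.prod_range_succ]
      simp only [Finset.range_zero, Finset.prod_empty] at this ⊢
      linear_combination (1 - p ^ (k + 1)) * this
    | k + 1, l + 1, h =>
      have h1 := ih k (l + 1) (by omega)
      have h2 := ih (k + 1) l (by omega)
      rw [Finset.prod_range_succ] at h1 h2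
      rw [qBinom_succ_succ, Finset.prod_range_succ, Finset.prod_range_succ,
        Finset.prod_range_succ _ n, show n + 1 = (k + 1) + (l + 1) by omega, pow_add p (k + 1)]
      linear_combination (1 - p ^ (k + 1)) * h1 + p ^ (k + 1) * (1 - p ^ (l + 1)) * h2

end QBinomial

theorem two_mul_int_choose (n : ℤ) :
    2 * (((n * (n + 1) / 2).toNat : ℕ) : ℤ) = n * (n + 1) := by
  have h0 : 0 ≤ n * (n + 1) := by nlinarith [sq_nonneg (2 * n + 1)]
  rw [Int.toNat_of_nonneg (Int.ediv_nonneg h0 (by norm_num)),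
    Int.mul_ediv_cancel' (Int.even_mul_succ_self n).two_dvd]

theorem two_mul_int_choose' (n : ℤ) :
    2 * (((n * (n - 1) / 2).toNat : ℕ) : ℤ) = n * (n - 1) := by
  have := two_mul_int_choose (n - 1)
  rwa [sub_add_cancel, mul_comm (n - 1)] at this

/-- The general term of Ramanujan's theta function `∑ a^{n(n+1)/2} b^{n(n-1)/2}`. -/
def thetaTerm {R : Type*} [CommRing R] (a b : R) (n : ℤ) : R :=
  a ^ (n * (n + 1) / 2).toNat * b ^ (n * (n - 1) / 2).toNat

theorem two_mul_choose_two (n : ℕ) : 2 * ((n.choose 2 : ℕ) : ℤ) = n * (n - 1) := by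
  induction n with
  | zero => simp
  | succ n ih =>
    rw [Nat.choose_succ_succ' n 1, Nat.choose_one_right]
    push_cast
    linarith

theorem finite_triple_product {R : Type*} [CommRing R] [IsDomain R] {a b : R} (ha : a ≠ 0)
    (hb : b ≠ 0) (N : ℕ) :
    (∏ i ∈ Finset.range N, (1 + a * (a * b) ^ i)) * (∏ i ∈ Finset.range N, (1 + b * (a * b) ^ i)) =
      ∑ n ∈ Finset.Icc (-N : ℤ) N, thetaTerm a b n * qBinom (a * b) (N + N) (N + n).toNat := by
  set p := a * b with hp
  have hp0 : p ≠ 0 := mul_ne_zero ha hb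
  have key := prod_add_mul_pow p a (p ^ N) (N + N)
  have e1 : ∏ i ∈ Finset.range N, (p ^ N + a * p ^ (N + i)) =
      p ^ (N * N) * ∏ i ∈ Finset.range N, (1 + a * p ^ i) := by
    rw [Finset.prod_congr rfl fun i _ => show p ^ N + a * p ^ (N + i) = p ^ N * (1 + a * p ^ i) by
      ring, Finset.prod_mul_distrib, Finset.prod_const, Finset.card_range, ← pow_mul]
  have e2 : ∏ i ∈ Finset.range N, (p ^ N + a * p ^ i) =
      a ^ N * p ^ (N.choose 2) * ∏ i ∈ Finset.range N, (1 + b * p ^ i) := by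
    have (i : ℕ) (hi : i ∈ Finset.range N) :
        p ^ N + a * p ^ i = a * p ^ i * (1 + b * p ^ (N - 1 - i)) := by
      have : N = i + (N - 1 - i) + 1 := by have := Finset.mem_range.mp hi; omega
      conv_lhs => rw [this]
      rw [pow_succ, pow_add]
      nth_rewrite 3 [hp]
      ring
    rw [Finset.prod_congr rfl this, Finset.prod_mul_distrib, Finset.prod_mul_distrib,
      Finset.prod_const, Finset.card_range, Finset.prod_pow_eq_pow_sum, Finset.sum_range_id,
      Nat.choose_two_right, Finset.prod_range_reflect (fun i => 1 + b * p ^ i)]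
  rw [Finset.prod_range_add, e1, e2] at key
  refine mul_left_cancel₀ (mul_ne_zero (mul_ne_zero (pow_ne_zero N ha)
    (pow_ne_zero (N.choose 2) hp0)) (pow_ne_zero (N * N) hp0)) ?_
  refine Eq.trans (by ring) (key.trans ?_)
  rw [Finset.mul_sum]
  refine Finset.sum_nbij' (fun k : ℕ => (k : ℤ) - N) (fun n => (N + n).toNat) ?_ ?_ ?_ ?_ ?_
  · intro k hk
    simp only [Finset.mem_range, Finset.mem_Icc] at hk ⊢
    omega
  · intro n hn
    simp only [Finset.mem_range, Finset.mem_Icc] at hn ⊢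
    omega
  · intro k hk
    simp
  · intro n hn
    simp only [Finset.mem_Icc] at hn
    omega
  · intro k hk
    have hk' : k ≤ N + N := by simp only [Finset.mem_range] at hk; omega
    rw [add_sub_cancel, Int.toNat_natCast, thetaTerm]
    obtain ⟨l, hl⟩ := Nat.exists_eq_add_of_le hk'
    have hl' : N + N - k = l := by omega
    rw [hl']
    have t1 := two_mul_int_choose ((k : ℤ) - N)
    have t2 := two_mul_int_choose' ((k : ℤ) - N)
    have t3 := two_mul_choose_two k
    have t4 := two_mul_choose_two N
    set u := ((((k : ℤ) - N) * (k - N + 1)) / 2).toNat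
    set v := ((((k : ℤ) - N) * (k - N - 1)) / 2).toNat
    have hlZ : (l : ℤ) = N + N - k := by omega
    have ea : k.choose 2 + N * l + k = N + N.choose 2 + N * N + u := by
      zify
      rw [hlZ]
      refine mul_left_cancel₀ (two_ne_zero (α := ℤ)) ?_
      linear_combination t3 - t4 - t1
    have eb : k.choose 2 + N * l = N.choose 2 + N * N + v := by
      zify
      rw [hlZ]
      refine mul_left_cancel₀ (two_ne_zero (α := ℤ)) ?_
      linear_combination t3 - t4 - t2
    calc _ = qBinom p (N + N) k * (a ^ (k.choose 2 + N * l + k) * b ^ (k.choose 2 + N * l)) := by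
          rw [hp]; ring
      _ = _ := by rw [ea, eb, hp]; ring

section Topology

variable {R : Type*} [CommRing R] [TopologicalSpace R]

theorem multipliable_one_add_of_dvd {c : ℕ → R⟦X⟧} (h : ∀ i, X ^ i ∣ c i) :
    Multipliable fun i => 1 + c i := by
  refine PowerSeries.WithPiTopology.multipliable_one_add_of_tendsto_order_atTop_nhds_top R ?_
  refine ENat.tendsto_nhds_top_iff_natCast_lt.mpr fun n => Filter.eventually_atTop.mpr
    ⟨n + 1, fun i hi => ?_⟩
  refine lt_of_lt_of_le (by exact_mod_cast hi) (nat_le_order _ i fun j hj => ?_)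
  exact X_pow_dvd_iff.mp (h i) j hj

theorem hasSum_of_dvd {ι : Type*} {t : ι → R⟦X⟧} {L : R⟦X⟧} (s : ℕ → Finset ι)
    (h₁ : ∀ d, ∀ n ∉ s d, X ^ (d + 1) ∣ t n) (h₂ : ∀ d, X ^ (d + 1) ∣ ∑ n ∈ s d, t n - L) :
    HasSum t L := by
  rw [WithPiTopology.hasSum_iff_hasSum_coeff]
  intro d
  have h := X_pow_dvd_iff.mp (h₂ d) d (Nat.lt_succ_self d)
  rw [map_sub, sub_eq_zero, map_sum] at h
  rw [← h]
  exact hasSum_sum_of_ne_finset_zero fun n hn => X_pow_dvd_iff.mp (h₁ d n hn) d (Nat.lt_succ_self d)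

theorem X_pow_dvd_tprod_sub_prod [T2Space R] {u : ℕ → R⟦X⟧} (hu : Multipliable u) (n k : ℕ)
    (h : ∀ i, k ≤ i → X ^ n ∣ u i - 1) : X ^ n ∣ ∏' i, u i - ∏ i ∈ Finset.range k, u i := by
  have key (l : ℕ) : X ^ n ∣ ∏ i ∈ Finset.range (l + k), u i - ∏ i ∈ Finset.range k, u i := by
    induction l with
    | zero => simp
    | succ l ih =>
      rw [Nat.add_right_comm, Finset.prod_range_succ]
      have := (ih.add ((h (l + k) (by omega)).mul_left (∏ i ∈ Finset.range (l + k), u i)))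
      convert this using 1
      ring
  refine X_pow_dvd_iff.mpr fun j hj => ?_
  rw [map_sub, sub_eq_zero]
  have ht := ((WithPiTopology.continuous_coeff R j).tendsto _).comp
    ((Filter.tendsto_add_atTop_iff_nat k).mpr hu.hasProd.tendsto_prod_nat)
  refine tendsto_nhds_unique ht (tendsto_const_nhds.congr fun l => ?_)
  have := X_pow_dvd_iff.mp (key l) j hj
  rw [map_sub, sub_eq_zero] at this
  exact this.symm

end Topology

theorem natAbs_sub_one_le (n : ℤ) :
    n.natAbs - 1 ≤ (n * (n + 1) / 2).toNat ∧ n.natAbs - 1 ≤ (n * (n - 1) / 2).toNat := by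
  have h1 := two_mul_int_choose n
  have h2 := two_mul_int_choose' n
  generalize (n * (n + 1) / 2).toNat = u at *
  generalize (n * (n - 1) / 2).toNat = v at *
  have h3 : ((n.natAbs - 1 : ℕ) : ℤ) ≤ u ∧ ((n.natAbs - 1 : ℕ) : ℤ) ≤ v := by
    rcases le_total 2 n with h | h
    · rw [show ((n.natAbs - 1 : ℕ) : ℤ) = n - 1 by omega]
      constructor <;> nlinarith
    · rcases le_total n (-2) with h' | h'
      · rw [show ((n.natAbs - 1 : ℕ) : ℤ) = -n - 1 by omega]
        constructor <;> nlinarith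
      · rw [show ((n.natAbs - 1 : ℕ) : ℤ) = if n = 2 ∨ n = -2 then 1 else 0 by split_ifs <;> omega]
        split_ifs with h0
        · rcases h0 with rfl | rfl <;> constructor <;> linarith
        · constructor <;> positivity
  exact_mod_cast h3

theorem X_pow_dvd_thetaTerm {a b : ℤ⟦X⟧} (hab : X ∣ a * b) (n : ℤ) :
    X ^ (n.natAbs - 1) ∣ thetaTerm a b n := by
  obtain ⟨h1, h2⟩ := natAbs_sub_one_le n
  refine (pow_dvd_pow_of_dvd hab _).trans ?_
  rw [mul_pow]
  exact mul_dvd_mul (pow_dvd_pow _ h1) (pow_dvd_pow _ h2)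

theorem X_pow_dvd_qBinom_mul_sub_one {p : ℤ⟦X⟧} (hp : X ∣ p) {d k l : ℕ} (hk : d ≤ k)
    (hl : d ≤ l) : X ^ d ∣ qBinom p (k + l) k * (∏' i : ℕ, (1 - p ^ (i + 1))) - 1 := by
  have hdvd (i : ℕ) : X ^ i ∣ -p ^ (i + 1) :=
    ((pow_dvd_pow X (Nat.le_succ i)).trans (pow_dvd_pow_of_dvd hp _)).neg_right
  have hm : Multipliable fun i : ℕ => 1 - p ^ (i + 1) := by
    simp_rw [sub_eq_add_neg]
    exact multipliable_one_add_of_dvd hdvd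
  have happ (n : ℕ) (hn : d ≤ n) :=
    X_pow_dvd_tprod_sub_prod hm d n fun i hi => by
      rw [sub_sub_cancel_left]
      exact (pow_dvd_pow X (hn.trans hi)).trans (hdvd i)
  have h := qBinom_mul_prod_mul_prod p k l
  obtain ⟨r₁, h₁⟩ := happ k hk
  obtain ⟨r₂, h₂⟩ := happ l hl
  obtain ⟨r₃, h₃⟩ := happ (k + l) (by omega)
  set P := ∏' i : ℕ, (1 - p ^ (i + 1))
  have hP : IsUnit P := by
    rw [isUnit_iff_constantCoeff]
    have h0 := X_pow_dvd_iff.mp (X_pow_dvd_tprod_sub_prod hm 1 0 fun i _ => by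
      rw [sub_sub_cancel_left, pow_one]
      exact (hp.trans (dvd_pow_self p (by omega))).neg_right) 0 one_pos
    rw [Finset.prod_range_zero, map_sub, sub_eq_zero, coeff_zero_eq_constantCoeff_apply,
      coeff_zero_eq_constantCoeff_apply, map_one] at h0
    rw [h0]
    exact isUnit_one
  refine (hP.dvd_mul_left (a := X ^ d)).mp ?_
  rw [sub_eq_iff_eq_add] at h₁ h₂ h₃
  set A := ∏ i ∈ Finset.range k, (1 - p ^ (i + 1))
  set B := ∏ i ∈ Finset.range l, (1 - p ^ (i + 1))
  refine ⟨qBinom p (k + l) k * (A * r₂ + r₁ * P) - r₃, ?_⟩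
  linear_combination h + qBinom p (k + l) k * (P * h₁ + A * h₂) - h₃

theorem hasSum_thetaTerm {a b : ℤ⟦X⟧} (ha : a ≠ 0) (hb : b ≠ 0) (hab : X ∣ a * b) :
    HasSum (thetaTerm a b) ((∏' i : ℕ, (1 + a * (a * b) ^ i)) * (∏' i : ℕ, (1 + b * (a * b) ^ i)) *
      ∏' i : ℕ, (1 - (a * b) ^ (i + 1))) := by
  have happ (c : ℤ⟦X⟧) (n : ℕ) :
      X ^ n ∣ ∏' i : ℕ, (1 + c * (a * b) ^ i) - ∏ i ∈ Finset.range n, (1 + c * (a * b) ^ i) := by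
    have hdvd (i : ℕ) : X ^ i ∣ c * (a * b) ^ i := (pow_dvd_pow_of_dvd hab i).mul_left c
    refine X_pow_dvd_tprod_sub_prod (multipliable_one_add_of_dvd hdvd) n n fun i hi => ?_
    rw [add_sub_cancel_left]
    exact (pow_dvd_pow X hi).trans (hdvd i)
  refine hasSum_of_dvd (fun d => Finset.Icc (-(d + 2 : ℕ) : ℤ) (d + 2 : ℕ)) ?_ ?_
  · intro d n hn
    refine (pow_dvd_pow X ?_).trans (X_pow_dvd_thetaTerm hab n)
    rw [Finset.mem_Icc] at hn
    omega
  · intro d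
    have hfin := finite_triple_product ha hb (d + 2)
    have hA := happ a (d + 2)
    have hB := happ b (d + 2)
    set N := d + 2 with hN
    set P := ∏' i : ℕ, (1 - (a * b) ^ (i + 1))
    have h1 : X ^ (d + 1) ∣ ∑ n ∈ Finset.Icc (-N : ℤ) N,
        (thetaTerm a b n - thetaTerm a b n * qBinom (a * b) (N + N) (N + n).toNat * P) := by
      refine Finset.dvd_sum fun n hn => ?_
      rw [Finset.mem_Icc] at hn
      have h2 := X_pow_dvd_qBinom_mul_sub_one hab (d := N - n.natAbs) (k := (N + n).toNat)
        (l := (N - n).toNat) (by omega) (by omega)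
      rw [show (N + n).toNat + (N - n).toNat = N + N by omega] at h2
      have h3 := (mul_dvd_mul (X_pow_dvd_thetaTerm hab n) h2).neg_right
      rw [← pow_add] at h3
      refine (pow_dvd_pow X (by omega)).trans (h3.trans (dvd_of_eq ?_))
      ring
    rw [Finset.sum_sub_distrib, ← Finset.sum_mul, ← hfin] at h1
    have hX : (X : ℤ⟦X⟧) ^ (d + 1) ∣ X ^ N := pow_dvd_pow X (by omega)
    set A := ∏' i : ℕ, (1 + a * (a * b) ^ i)
    set A' := ∏ i ∈ Finset.range N, (1 + a * (a * b) ^ i)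
    set B := ∏' i : ℕ, (1 + b * (a * b) ^ i)
    set B' := ∏ i ∈ Finset.range N, (1 + b * (a * b) ^ i)
    have := h1.sub (((hX.trans hA).mul_left (B * P)).add ((hX.trans hB).mul_left (A' * P)))
    convert this using 1
    ring

section ThreeParts

variable {M β γ : Type*} [CommMonoid M] [TopologicalSpace M] [ContinuousMul M]

@[to_additive]
theorem hasProd_of_three_parts {u : γ → M} {g₀ g₁ g₂ : β → γ} {a b c : M}
    (h₀ : g₀.Injective) (h₁ : g₁.Injective) (h₂ : g₂.Injective)
    (h₀₁ : ∀ i j, g₀ i ≠ g₁ j) (h₀₂ : ∀ i j, g₀ i ≠ g₂ j) (h₁₂ : ∀ i j, g₁ i ≠ g₂ j)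
    (hcover : ∀ n, (∃ i, g₀ i = n) ∨ (∃ i, g₁ i = n) ∨ ∃ i, g₂ i = n)
    (ha : HasProd (fun i => u (g₀ i)) a) (hb : HasProd (fun i => u (g₁ i)) b)
    (hc : HasProd (fun i => u (g₂ i)) c) : HasProd u (a * b * c) := by
  have ha' := h₀.hasProd_range_iff.mpr ha
  have hb' := h₁.hasProd_range_iff.mpr hb
  have hc' := h₂.hasProd_range_iff.mpr hc
  have d₀₁ : Disjoint (Set.range g₀) (Set.range g₁) := by
    rw [Set.disjoint_left]
    rintro _ ⟨i, rfl⟩ ⟨j, hj⟩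
    exact h₀₁ i j hj.symm
  have hcompl : IsCompl (Set.range g₀ ∪ Set.range g₁) (Set.range g₂) := by
    constructor
    · rw [Set.disjoint_left]
      rintro _ (⟨i, rfl⟩ | ⟨i, rfl⟩) ⟨j, hj⟩
      · exact h₀₂ i j hj.symm
      · exact h₁₂ i j hj.symm
    · rw [codisjoint_iff_le_sup]
      rintro n -
      rcases hcover n with h | h | h
      · exact Or.inl (Or.inl h)
      · exact Or.inl (Or.inr h)
      · exact Or.inr h
  exact (HasProd.mul_disjoint d₀₁ ha' hb').mul_isCompl hcompl hc'

theorem hasProd_nat_of_mod_three {u : ℕ → M} {a b c : M}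
    (ha : HasProd (fun i => u (3 * i)) a) (hb : HasProd (fun i => u (3 * i + 1)) b)
    (hc : HasProd (fun i => u (3 * i + 2)) c) : HasProd u (a * b * c) := by
  refine hasProd_of_three_parts (g₀ := fun i => 3 * i) (g₁ := fun i => 3 * i + 1)
    (g₂ := fun i => 3 * i + 2) ?_ ?_ ?_ ?_ ?_ ?_ ?_ ha hb hc
  · intro i j h; simp only at h; omega
  · intro i j h; simp only at h; omega
  · intro i j h; simp only at h; omega
  · intro i j; omega
  · intro i j; omega
  · intro i j; omega
  · intro n
    have h : n % 3 < 3 := Nat.mod_lt _ (by norm_num)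
    interval_cases hn : n % 3
    · exact Or.inl ⟨n / 3, by omega⟩
    · exact Or.inr (Or.inl ⟨n / 3, by omega⟩)
    · exact Or.inr (Or.inr ⟨n / 3, by omega⟩)

end ThreeParts

theorem multipliable_one_add_X_pow {k l : ℕ} (hk : 0 < k) :
    Multipliable fun i : ℕ => (1 + X ^ (k * i + l) : ℤ⟦X⟧) :=
  multipliable_one_add_of_dvd fun _ => pow_dvd_pow X
    ((Nat.le_mul_of_pos_left _ hk).trans (Nat.le_add_right _ _))

theorem multipliable_one_sub_X_pow {R : Type*} [CommRing R] [TopologicalSpace R] {k l : ℕ}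
    (hk : 0 < k) : Multipliable fun i : ℕ => (1 - X ^ (k * i + l) : R⟦X⟧) := by
  simp_rw [sub_eq_add_neg]
  exact multipliable_one_add_of_dvd fun _ => (pow_dvd_pow X
    ((Nat.le_mul_of_pos_left _ hk).trans (Nat.le_add_right _ _))).neg_right

/-- `∏_{i ≥ 0} (1 - q^{k i + l})`. -/
noncomputable def subProd (k l : ℕ) : ℤ⟦X⟧ := ∏' i : ℕ, (1 - X ^ (k * i + l))

/-- `∏_{i ≥ 0} (1 + q^{k i + l})`. -/
noncomputable def addProd (k l : ℕ) : ℤ⟦X⟧ := ∏' i : ℕ, (1 + X ^ (k * i + l))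

theorem hasProd_subProd {k l : ℕ} (hk : 0 < k) :
    HasProd (fun i : ℕ => (1 - X ^ (k * i + l) : ℤ⟦X⟧)) (subProd k l) :=
  (multipliable_one_sub_X_pow hk).hasProd

theorem hasProd_addProd {k l : ℕ} (hk : 0 < k) :
    HasProd (fun i : ℕ => (1 + X ^ (k * i + l) : ℤ⟦X⟧)) (addProd k l) :=
  (multipliable_one_add_X_pow hk).hasProd

theorem subProd_self (k : ℕ) : subProd k k = f k := rfl

theorem subProd_mul_addProd {k l : ℕ} (hk : 0 < k) :
    addProd k l * subProd k l = subProd (2 * k) (2 * l) := by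
  refine (((hasProd_addProd hk).mul (hasProd_subProd hk)).congr_fun ?_).unique
    (hasProd_subProd (by omega))
  intro i
  ring

theorem subProd_two_mul {k l : ℕ} (hk : 0 < k) :
    subProd (2 * k) l * subProd (2 * k) (k + l) = subProd k l := by
  refine HasProd.unique ?_ (hasProd_subProd hk)
  refine HasProd.even_mul_odd ((hasProd_subProd (by omega)).congr_fun ?_)
    ((hasProd_subProd (by omega)).congr_fun ?_) <;> intro i <;> ring

theorem subProd_three_mul {k l : ℕ} (hk : 0 < k) :
    subProd (3 * k) l * subProd (3 * k) (k + l) * subProd (3 * k) (2 * k + l) = subProd k l := by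
  refine HasProd.unique ?_ (hasProd_subProd hk)
  refine hasProd_nat_of_mod_three ((hasProd_subProd (by omega)).congr_fun ?_)
    ((hasProd_subProd (by omega)).congr_fun ?_)
    ((hasProd_subProd (by omega)).congr_fun ?_) <;> intro i <;> ring

theorem addProd_three_mul {k l : ℕ} (hk : 0 < k) :
    addProd (3 * k) l * addProd (3 * k) (k + l) * addProd (3 * k) (2 * k + l) = addProd k l := by
  refine HasProd.unique ?_ (hasProd_addProd hk)
  refine hasProd_nat_of_mod_three ((hasProd_addProd (by omega)).congr_fun ?_)
    ((hasProd_addProd (by omega)).congr_fun ?_)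
    ((hasProd_addProd (by omega)).congr_fun ?_) <;> intro i <;> ring

theorem addProd_one_zero : addProd 1 0 = 2 * addProd 1 1 := by
  rw [addProd, addProd, tprod_eq_zero_mul']
  · norm_num
  · exact multipliable_one_add_X_pow one_pos

/-- Ramanujan's `φ(-q)` as a product. -/
noncomputable def phi : ℤ⟦X⟧ := subProd 2 1 * subProd 2 1 * f 2

/-- Ramanujan's `ψ(q)` as a product. -/
noncomputable def psi : ℤ⟦X⟧ := addProd 1 1 * f 2

theorem phi_mul : phi * f 2 = f 1 ^ 2 := by
  have h := subProd_two_mul (k := 1) (l := 1) one_pos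
  rw [← subProd_self 1, ← h, phi, ← subProd_self 2]
  ring

theorem psi_mul : psi * f 1 = f 2 ^ 2 := by
  have h := subProd_mul_addProd (k := 1) (l := 1) one_pos
  rw [psi, ← subProd_self 1, ← subProd_self 2]
  linear_combination subProd 2 2 * h

theorem hasSum_phi : HasSum (thetaTerm ((-X) ^ 1) ((-X) ^ 1 : ℤ⟦X⟧)) phi := by
  have h := hasSum_thetaTerm (a := (-X) ^ 1) (b := (-X) ^ 1) (by simp) (by simp) ⟨X, by ring⟩
  have h1 : ∏' i : ℕ, (1 + (-X) ^ 1 * ((-X) ^ 1 * (-X) ^ 1) ^ i : ℤ⟦X⟧) = subProd 2 1 :=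
    tprod_congr fun i => by ring
  have h2 : ∏' i : ℕ, (1 - ((-X) ^ 1 * (-X) ^ 1) ^ (i + 1) : ℤ⟦X⟧) = f 2 :=
    tprod_congr fun i => by ring
  rwa [h1, h2] at h

theorem hasSum_two_mul_psi : HasSum (thetaTerm (X ^ 0) (X ^ 1 : ℤ⟦X⟧)) (2 * psi) := by
  have h := hasSum_thetaTerm (a := X ^ 0) (b := X ^ 1) (by simp) (by simp) ⟨1, by ring⟩
  have h1 : ∏' i : ℕ, (1 + X ^ 0 * (X ^ 0 * X ^ 1) ^ i : ℤ⟦X⟧) = addProd 1 0 :=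
    tprod_congr fun i => by ring
  have h2 : ∏' i : ℕ, (1 + X ^ 1 * (X ^ 0 * X ^ 1) ^ i : ℤ⟦X⟧) = addProd 1 1 :=
    tprod_congr fun i => by ring
  have h3 : ∏' i : ℕ, (1 - (X ^ 0 * X ^ 1) ^ (i + 1) : ℤ⟦X⟧) = f 1 :=
    tprod_congr fun i => by ring
  rw [h1, h2, h3, addProd_one_zero] at h
  have h4 := subProd_mul_addProd (k := 1) (l := 1) one_pos
  convert h using 1
  rw [psi, ← subProd_self 1, ← subProd_self 2]
  linear_combination -2 * addProd 1 1 * h4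

theorem exists_hasSum_theta_five_one :
    ∃ S : ℤ⟦X⟧, HasSum (thetaTerm ((-X) ^ 5) ((-X) ^ 1 : ℤ⟦X⟧)) S ∧
      S * (f 2 * f 3) = f 1 * f 6 ^ 2 := by
  have h := hasSum_thetaTerm (a := (-X) ^ 5) (b := (-X) ^ 1) (by simp) (by simp) ⟨X ^ 5, by ring⟩
  have h1 : ∏' i : ℕ, (1 + (-X) ^ 5 * ((-X) ^ 5 * (-X) ^ 1) ^ i : ℤ⟦X⟧) = subProd 6 5 :=
    tprod_congr fun i => by ring
  have h2 : ∏' i : ℕ, (1 + (-X) ^ 1 * ((-X) ^ 5 * (-X) ^ 1) ^ i : ℤ⟦X⟧) = subProd 6 1 :=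
    tprod_congr fun i => by ring
  have h3 : ∏' i : ℕ, (1 - ((-X) ^ 5 * (-X) ^ 1) ^ (i + 1) : ℤ⟦X⟧) = f 6 :=
    tprod_congr fun i => by ring
  rw [h1, h2, h3] at h
  refine ⟨_, h, ?_⟩
  have e1 := subProd_two_mul (k := 1) (l := 1) one_pos
  have e2 := subProd_two_mul (k := 3) (l := 3) (by norm_num)
  have e3 := subProd_three_mul (k := 2) (l := 1) (by norm_num)
  norm_num at e1 e2 e3
  rw [← subProd_self 1, ← subProd_self 2, ← subProd_self 3, ← subProd_self 6, ← e2, ← e1, ← e3]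
  ring

theorem exists_hasSum_theta_one_two :
    ∃ S : ℤ⟦X⟧, HasSum (thetaTerm (X ^ 1) (X ^ 2 : ℤ⟦X⟧)) S ∧
      S * (f 1 * f 6) = f 2 * f 3 ^ 2 := by
  have h := hasSum_thetaTerm (a := X ^ 1) (b := X ^ 2) (by simp) (by simp) ⟨X ^ 2, by ring⟩
  have h1 : ∏' i : ℕ, (1 + X ^ 1 * (X ^ 1 * X ^ 2) ^ i : ℤ⟦X⟧) = addProd 3 1 :=
    tprod_congr fun i => by ring
  have h2 : ∏' i : ℕ, (1 + X ^ 2 * (X ^ 1 * X ^ 2) ^ i : ℤ⟦X⟧) = addProd 3 2 :=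
    tprod_congr fun i => by ring
  have h3 : ∏' i : ℕ, (1 - (X ^ 1 * X ^ 2) ^ (i + 1) : ℤ⟦X⟧) = f 3 :=
    tprod_congr fun i => by ring
  rw [h1, h2, h3] at h
  refine ⟨_, h, ?_⟩
  have e1 := subProd_mul_addProd (k := 1) (l := 1) one_pos
  have e2 := subProd_mul_addProd (k := 3) (l := 3) (by norm_num)
  have e3 := addProd_three_mul (k := 1) (l := 1) (by norm_num)
  norm_num at e1 e2 e3
  rw [← subProd_self 1, ← subProd_self 2, ← subProd_self 3, ← subProd_self 6, ← e2, ← e1, ← e3]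
  ring

theorem continuous_expand {R : Type*} [CommRing R] [TopologicalSpace R] {r : ℕ} (hr : r ≠ 0) :
    Continuous (expand (R := R) r hr) := by
  refine continuous_iff_continuousAt.mpr fun F => ?_
  refine (WithPiTopology.tendsto_iff_coeff_tendsto _ _ _ _).mpr fun d => ?_
  simp only [coeff_expand]
  split_ifs
  · exact (WithPiTopology.continuous_coeff R _).tendsto F
  · exact tendsto_const_nhds

theorem expand_f {r : ℕ} (hr : r ≠ 0) {k : ℕ} (hk : 0 < k) : expand r hr (f k) = f (r * k) := by
  rw [f, (multipliable_f hk).map_tprod (expand r hr) (continuous_expand hr), f]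
  refine tprod_congr fun i => ?_
  rw [map_sub, map_one, map_pow, expand_X, ← pow_mul, mul_assoc]

theorem expand_thetaTerm {r : ℕ} (hr : r ≠ 0) {y : ℤ⟦X⟧} (hy : expand r hr y = y ^ r) (i j : ℕ)
    (n : ℤ) : expand r hr (thetaTerm (y ^ i) (y ^ j) n) = thetaTerm (y ^ i) (y ^ j) n ^ r := by
  simp only [thetaTerm, map_mul, map_pow, hy]
  ring

theorem thetaTerm_eq_pow_mul {R : Type*} [CommRing R] (y : R) {i j i' j' c r : ℕ} {n k : ℤ}
    (h : i * (n * (n + 1)) + j * (n * (n - 1)) =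
      2 * c + r * (i' * (k * (k + 1)) + j' * (k * (k - 1)))) :
    thetaTerm (y ^ i) (y ^ j) n = y ^ c * thetaTerm (y ^ i') (y ^ j') k ^ r := by
  have t1 := two_mul_int_choose n
  have t2 := two_mul_int_choose' n
  have t3 := two_mul_int_choose k
  have t4 := two_mul_int_choose' k
  rw [thetaTerm, thetaTerm]
  generalize (n * (n + 1) / 2).toNat = u₁ at *
  generalize (n * (n - 1) / 2).toNat = u₂ at *
  generalize (k * (k + 1) / 2).toNat = u₃ at *
  generalize (k * (k - 1) / 2).toNat = u₄ at *
  have e : i * u₁ + j * u₂ = c + r * (i' * u₃ + j' * u₄) := by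
    zify
    refine mul_left_cancel₀ (two_ne_zero (α := ℤ)) ?_
    linear_combination h + i * t1 + j * t2 - r * (i' * t3 + j' * t4)
  calc _ = y ^ (i * u₁ + j * u₂) := by ring
    _ = _ := by rw [e]; ring

theorem phi_dissection {S : ℤ⟦X⟧} (hS : HasSum (thetaTerm ((-X) ^ 5) ((-X) ^ 1 : ℤ⟦X⟧)) S) :
    phi = expand 9 (by norm_num) phi - 2 * X * expand 3 (by norm_num) S := by
  have h0 := hasSum_phi.map (expand 9 (by norm_num)) (continuous_expand (by norm_num))
  have h1 := (hS.map (expand 3 (by norm_num)) (continuous_expand (by norm_num))).mul_left (-X)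
  refine hasSum_phi.unique ?_
  have e9 : expand 9 (by norm_num) (-X : ℤ⟦X⟧) = (-X) ^ 9 := by
    rw [map_neg, expand_X]; ring
  have e3 : expand 3 (by norm_num) (-X : ℤ⟦X⟧) = (-X) ^ 3 := by
    rw [map_neg, expand_X]; ring
  convert hasSum_of_three_parts (g₀ := fun k : ℤ => 3 * k) (g₁ := fun k => 3 * k + 1)
    (g₂ := fun k => -(3 * k + 1)) ?_ ?_ ?_ ?_ ?_ ?_ ?_ (h0.congr_fun ?_) (h1.congr_fun ?_)
    (h1.congr_fun ?_) using 1
  · ring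
  · intro i j h; simp only at h; omega
  · intro i j h; simp only at h; omega
  · intro i j h; simp only at h; omega
  · intro i j; omega
  · intro i j; omega
  · intro i j; omega
  · intro n
    rcases (by omega : n % 3 = 0 ∨ n % 3 = 1 ∨ n % 3 = 2) with h | h | h
    · exact Or.inl ⟨n / 3, by omega⟩
    · exact Or.inr (Or.inl ⟨n / 3, by omega⟩)
    · exact Or.inr (Or.inr ⟨-(n / 3) - 1, by omega⟩)
  · intro k
    rw [Function.comp_apply, expand_thetaTerm _ e9, ← one_mul (_ ^ 9), ← pow_zero (-X)]
    exact thetaTerm_eq_pow_mul _ (by push_cast; ring)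
  · intro k
    rw [Function.comp_apply, expand_thetaTerm _ e3]
    conv_rhs => rw [← pow_one (-X : ℤ⟦X⟧)]
    rw [thetaTerm_eq_pow_mul (-X) (i := 1) (j := 1) (i' := 5) (j' := 1) (c := 1) (r := 3) (k := k)]
    · simp only [pow_one]
    · push_cast; ring
  · intro k
    rw [Function.comp_apply, expand_thetaTerm _ e3]
    rw [thetaTerm_eq_pow_mul (-X) (i := 1) (j := 1) (i' := 5) (j' := 1) (c := 1) (r := 3) (k := k)]
    · simp only [pow_one]
    · push_cast; ring

theorem psi_dissection {S : ℤ⟦X⟧} (hS : HasSum (thetaTerm (X ^ 1) (X ^ 2 : ℤ⟦X⟧)) S) :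
    psi = expand 3 (by norm_num) S + X * expand 9 (by norm_num) psi := by
  have h0 := (hasSum_two_mul_psi.map (expand 9 (by norm_num))
    (continuous_expand (by norm_num))).mul_left X
  have h1 := hS.map (expand 3 (by norm_num)) (continuous_expand (by norm_num))
  refine mul_left_cancel₀ (show (2 : ℤ⟦X⟧) ≠ 0 from ?_) ?_
  · intro h
    have h' := congrArg constantCoeff h
    rw [map_ofNat, map_zero] at h'
    exact two_ne_zero h'
  refine hasSum_two_mul_psi.unique ?_
  have e9 : expand 9 (by norm_num) (X : ℤ⟦X⟧) = X ^ 9 := expand_X _ _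
  have e3 : expand 3 (by norm_num) (X : ℤ⟦X⟧) = X ^ 3 := expand_X _ _
  convert hasSum_of_three_parts (g₀ := fun k : ℤ => 3 * k) (g₁ := fun k => 1 - 3 * k)
    (g₂ := fun k => 3 * k - 1) ?_ ?_ ?_ ?_ ?_ ?_ ?_ (h1.congr_fun ?_) (h1.congr_fun ?_)
    (h0.congr_fun ?_) using 1
  · rw [map_mul, map_ofNat]; ring
  · intro i j h; simp only at h; omega
  · intro i j h; simp only at h; omega
  · intro i j h; simp only at h; omega
  · intro i j; omega
  · intro i j; omega
  · intro i j; omega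
  · intro n
    rcases (by omega : n % 3 = 0 ∨ n % 3 = 1 ∨ n % 3 = 2) with h | h | h
    · exact Or.inl ⟨n / 3, by omega⟩
    · exact Or.inr (Or.inl ⟨-(n / 3), by omega⟩)
    · exact Or.inr (Or.inr ⟨n / 3 + 1, by omega⟩)
  · intro k
    rw [Function.comp_apply, expand_thetaTerm _ e3, ← one_mul (_ ^ 3), ← pow_zero X]
    exact thetaTerm_eq_pow_mul _ (by push_cast; ring)
  · intro k
    rw [Function.comp_apply, expand_thetaTerm _ e3, ← one_mul (_ ^ 3), ← pow_zero X]
    exact thetaTerm_eq_pow_mul _ (by push_cast; ring)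
  · intro k
    rw [Function.comp_apply, expand_thetaTerm _ e9]
    rw [thetaTerm_eq_pow_mul X (i := 0) (j := 1) (i' := 0) (j' := 1) (c := 1) (r := 9) (k := k)]
    · rw [pow_one]
    · push_cast; ring

theorem f_ne_zero {k : ℕ} (hk : 0 < k) : f k ≠ 0 := fun h => by
  have := constantCoeff_f hk
  rw [h, map_zero] at this
  exact zero_ne_one this

/-- Ramanujan's cubic continued fraction `f₁ f₆³ / (f₂ f₃³)`, without the factor `q^{1/3}`. -/
noncomputable def cubicFrac : ℤ⟦X⟧ := f 1 * f 6 ^ 3 * invOfUnit (f 2 * f 3 ^ 3) 1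

/-- The inverse of `cubicFrac`. -/
noncomputable def cubicFracInv : ℤ⟦X⟧ := f 2 * f 3 ^ 3 * invOfUnit (f 1 * f 6 ^ 3) 1

theorem cubicFrac_mul : cubicFrac * (f 2 * f 3 ^ 3) = f 1 * f 6 ^ 3 := by
  rw [cubicFrac, mul_assoc, invOfUnit_mul, mul_one]
  simp [constantCoeff_f]

theorem cubicFracInv_mul : cubicFracInv * (f 1 * f 6 ^ 3) = f 2 * f 3 ^ 3 := by
  rw [cubicFracInv, mul_assoc, invOfUnit_mul, mul_one]
  simp [constantCoeff_f]

theorem cubicFracInv_mul_cubicFrac : cubicFracInv * cubicFrac = 1 := by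
  have h1 := f_ne_zero (k := 1) (by norm_num)
  have h6 := f_ne_zero (k := 6) (by norm_num)
  refine mul_right_cancel₀ (mul_ne_zero h1 (pow_ne_zero 3 h6)) ?_
  linear_combination cubicFrac * cubicFracInv_mul + cubicFrac_mul

/-- The substitution `q ↦ q³`. -/
noncomputable def cubeSubst : ℤ⟦X⟧ →ₐ[ℤ] ℤ⟦X⟧ := expand 3 (by norm_num)

theorem cubeSubst_f {k : ℕ} (hk : 0 < k) : cubeSubst (f k) = f (3 * k) := expand_f _ hk

theorem f_one_mul_f_two : f 1 * f 2 = f 9 * f 18 *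
    (cubeSubst cubicFracInv - X - 2 * X ^ 2 * cubeSubst cubicFrac) := by
  obtain ⟨H, hH, hH'⟩ := exists_hasSum_theta_five_one
  obtain ⟨G, hG, hG'⟩ := exists_hasSum_theta_one_two
  have n1 := f_ne_zero (k := 1) (by norm_num)
  have n2 := f_ne_zero (k := 2) (by norm_num)
  have n3 := f_ne_zero (k := 3) (by norm_num)
  have n6 := f_ne_zero (k := 6) (by norm_num)
  have n9 := f_ne_zero (k := 9) (by norm_num)
  have n18 := f_ne_zero (k := 18) (by norm_num)
  have e : f 1 * f 2 = phi * psi := by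
    refine mul_right_cancel₀ (mul_ne_zero n1 n2) ?_
    linear_combination -psi * f 1 * phi_mul - f 1 ^ 2 * psi_mul
  have hphi := congrArg (expand 9 (by norm_num)) phi_mul
  have hpsi := congrArg (expand 9 (by norm_num)) psi_mul
  have hH3 := congrArg cubeSubst hH'
  have hG3 := congrArg cubeSubst hG'
  have hw := congrArg cubeSubst cubicFrac_mul
  have hw' := congrArg cubeSubst cubicFracInv_mul
  simp only [map_mul, map_pow, expand_f, cubeSubst_f, Nat.reduceMul, Nat.zero_lt_succ]
    at hphi hpsi hH3 hG3 hw hw'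
  have dphi := phi_dissection hH
  have dpsi := psi_dissection hG
  change phi = _ - 2 * X * cubeSubst H at dphi
  change psi = cubeSubst G + _ at dpsi
  generalize expand 9 _ phi = P at *
  generalize expand 9 _ psi = S at *
  have c0 : P * cubeSubst G = f 9 * f 18 * cubeSubst cubicFracInv := by
    refine mul_right_cancel₀ (mul_ne_zero n3 (pow_ne_zero 2 n18)) ?_
    linear_combination cubeSubst G * f 3 * f 18 * hphi + f 9 ^ 2 * hG3 - f 9 * hw'
  have c1 : P * S = f 9 * f 18 := by
    refine mul_right_cancel₀ (mul_ne_zero n9 n18) ?_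
    linear_combination S * f 9 * hphi + f 9 ^ 2 * hpsi
  have c2 : cubeSubst H * cubeSubst G = f 9 * f 18 := by
    refine mul_right_cancel₀ (mul_ne_zero (mul_ne_zero n6 n9) (mul_ne_zero n3 n18)) ?_
    linear_combination cubeSubst G * f 3 * f 18 * hH3 + f 3 * f 18 ^ 2 * hG3
  have c3 : cubeSubst H * S = f 9 * f 18 * cubeSubst cubicFrac := by
    refine mul_right_cancel₀ (mul_ne_zero n6 (pow_ne_zero 3 n9)) ?_
    linear_combination f 9 ^ 2 * S * hH3 + f 9 * f 3 * f 18 ^ 2 * hpsi - f 9 * f 18 * hw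
  rw [e, dphi, dpsi]
  linear_combination c0 + X * c1 - 2 * X * c2 - 2 * X ^ 2 * c3

section Norm

/-- The substitution `q ↦ z q`, with coefficients extended to `ℂ`. -/
noncomputable def twist (z : ℂ) : ℤ⟦X⟧ →+* ℂ⟦X⟧ := (rescale z).comp (map (Int.castRingHom ℂ))

theorem coeff_twist (z : ℂ) (F : ℤ⟦X⟧) (n : ℕ) : coeff n (twist z F) = z ^ n * (coeff n F : ℤ) := by
  simp [twist, coeff_rescale]

theorem twist_X (z : ℂ) : twist z X = C z * X := by
  simp [twist, rescale_X]

theorem twist_one_injective : Function.Injective (twist 1) := fun F G h => by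
  ext n
  have := congrArg (coeff n) h
  simpa [coeff_twist] using this

theorem continuous_twist (z : ℂ) : Continuous (twist z) := by
  refine continuous_iff_continuousAt.mpr fun F => ?_
  refine (WithPiTopology.tendsto_iff_coeff_tendsto _ _ _ _).mpr fun d => ?_
  simp only [coeff_twist]
  refine Filter.Tendsto.const_mul _ ?_
  exact ((continuous_of_discreteTopology (f := fun n : ℤ => (n : ℂ))).tendsto _).comp
    ((WithPiTopology.continuous_coeff ℤ d).tendsto F)

theorem twist_cubeSubst {z : ℂ} (hz : z ^ 3 = 1) (F : ℤ⟦X⟧) :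
    twist z (cubeSubst F) = twist 1 (cubeSubst F) := by
  ext n
  rw [coeff_twist, coeff_twist, cubeSubst, coeff_expand]
  split_ifs with h
  · obtain ⟨k, rfl⟩ := h
    rw [pow_mul, hz, one_pow, one_pow]
  · simp

theorem hasProd_twist_subProd (z : ℂ) {k l : ℕ} (hk : 0 < k) :
    HasProd (fun i : ℕ => (1 - C (z ^ (k * i + l)) * X ^ (k * i + l) : ℂ⟦X⟧))
      (twist z (subProd k l)) := by
  refine ((hasProd_subProd hk).map (twist z) (continuous_twist z)).congr_fun fun i => ?_
  rw [Function.comp_apply, map_sub, map_one, map_pow (twist z), twist_X, mul_pow,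
    map_pow]

theorem one_sub_mul_one_sub_mul_one_sub {w : ℂ} (hw : w ^ 3 = 1)
    (hw' : w ^ 2 + w + 1 = 0) {k : ℕ} (hk : k % 3 = 1 ∨ k % 3 = 2) (T : ℂ⟦X⟧) :
    (1 - C (1 ^ k) * T) * (1 - C (w ^ k) * T) * (1 - C ((w ^ 2) ^ k) * T) = 1 - T ^ 3 := by
  have e : C (w ^ k) = C w ^ (k % 3) := by
    conv_lhs => rw [← Nat.div_add_mod k 3, pow_add, pow_mul, hw, one_pow, one_mul, map_pow]
  have h3 : (C w : ℂ⟦X⟧) ^ 3 = 1 := by rw [← map_pow, hw, map_one]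
  have h2 : (C w : ℂ⟦X⟧) ^ 2 + C w + 1 = 0 := by
    rw [← map_pow, ← map_one C, ← map_add, ← map_add, hw', map_zero]
  rw [pow_right_comm, map_pow C (w ^ k) 2, e, one_pow, map_one]
  generalize (C w : ℂ⟦X⟧) = z at *
  rcases hk with h | h <;> rw [h]
  · linear_combination (T ^ 2 - T ^ 3) * h3 - (1 - T) * T * h2
  · linear_combination ((T ^ 2 - T ^ 3) * (z ^ 3 + 1) - (1 - T) * T * z) * h3 - (1 - T) * T * h2

theorem twist_f_norm {w : ℂ} (hw : w ^ 3 = 1)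
    (hw' : w ^ 2 + w + 1 = 0) {k : ℕ} (hk : k = 1 ∨ k = 2) :
    twist 1 (f k) * twist w (f k) * twist (w ^ 2) (f k) * twist 1 (f (9 * k)) =
      twist 1 (f (3 * k)) ^ 4 := by
  have hk0 : 0 < k := by omega
  have hprod := ((hasProd_twist_subProd 1 (l := k) hk0).mul
    (hasProd_twist_subProd w (l := k) hk0)).mul (hasProd_twist_subProd (w ^ 2) (l := k) hk0)
  have h0 := hasProd_twist_subProd 1 (k := 9 * k) (l := 3 * k) (by omega)
  have h1 := hasProd_twist_subProd 1 (k := 9 * k) (l := 6 * k) (by omega)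
  have h2 := hasProd_twist_subProd 1 (k := 3 * k) (l := 3 * k) (by omega)
  have key := hprod.unique (hasProd_nat_of_mod_three (h0.congr_fun fun i => ?_)
    (h1.congr_fun fun i => ?_) (((h2.mul h2).mul h2).congr_fun fun i => ?_))
  · have hs := congrArg (twist 1) (subProd_three_mul (k := 3 * k) (l := 3 * k) (by omega))
    rw [map_mul, map_mul, show 3 * (3 * k) = 9 * k by ring, show 3 * k + 3 * k = 6 * k by ring,
      show 2 * (3 * k) + 3 * k = 9 * k by ring, subProd_self, subProd_self] at hs
    rw [subProd_self, subProd_self] at key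
    linear_combination twist 1 (f (9 * k)) * key + twist 1 (f (3 * k)) ^ 3 * hs
  · rw [one_sub_mul_one_sub_mul_one_sub hw hw' (by rcases hk with rfl | rfl <;> omega), one_pow,
      map_one]
    ring
  · rw [one_sub_mul_one_sub_mul_one_sub hw hw' (by rcases hk with rfl | rfl <;> omega), one_pow,
      map_one]
    ring
  · have e : k * (3 * i + 2) + k = 3 * (k * (i + 1)) := by ring
    have e' : 3 * k * i + 3 * k = 3 * (k * (i + 1)) := by ring
    rw [e, e', pow_right_comm, pow_mul w, hw]
    simp only [one_pow, map_one]

end Norm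

theorem exists_primitive_cube_root : ∃ w : ℂ, w ^ 3 = 1 ∧ w ^ 2 + w + 1 = 0 := by
  have h := Complex.isPrimitiveRoot_exp 3 (by norm_num)
  refine ⟨_, h.pow_eq_one, ?_⟩
  have h1 := h.ne_one (by norm_num)
  refine mul_left_cancel₀ (sub_ne_zero.mpr h1) ?_
  linear_combination h.pow_eq_one

theorem cubeSubst_quot_mul : cubeSubst quot * (f 3 * f 6) = f 9 * f 18 := by
  have h := congrArg cubeSubst quot_mul
  simpa only [map_mul, cubeSubst_f, Nat.reduceMul, Nat.zero_lt_succ] using h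

theorem quot_mul_cubeSubst_quot_mul : quot * cubeSubst quot *
    (cubeSubst cubicFracInv - X - 2 * X ^ 2 * cubeSubst cubicFrac) = 1 := by
  have n3 := f_ne_zero (k := 3) (by norm_num)
  have n6 := f_ne_zero (k := 6) (by norm_num)
  refine mul_right_cancel₀ (mul_ne_zero n3 n6) ?_
  linear_combination quot * (cubeSubst cubicFracInv - X - 2 * X ^ 2 * cubeSubst cubicFrac) *
    cubeSubst_quot_mul - quot * f_one_mul_f_two + quot_mul

theorem cubicFrac_relation : (cubeSubst cubicFracInv ^ 3 - 7 * X ^ 3 -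
    8 * X ^ 6 * cubeSubst cubicFrac ^ 3) * cubeSubst quot ^ 4 = 1 := by
  obtain ⟨w, hw, hw'⟩ := exists_primitive_cube_root
  have h1 := twist_f_norm hw hw' (Or.inl rfl)
  have h2 := twist_f_norm hw hw' (Or.inr rfl)
  norm_num only at h1 h2
  have hax : cubeSubst cubicFracInv * cubeSubst cubicFrac = 1 := by
    rw [← map_mul, cubicFracInv_mul_cubicFrac, map_one]
  have n3 := f_ne_zero (k := 3) (by norm_num)
  have n6 := f_ne_zero (k := 6) (by norm_num)
  refine mul_right_cancel₀ (pow_ne_zero 4 (mul_ne_zero n3 n6)) ?_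
  rw [mul_assoc, ← mul_pow, cubeSubst_quot_mul, one_mul]
  have h9 : f 9 * f 18 = cubeSubst (f 3 * f 6) := by
    rw [map_mul, cubeSubst_f (by norm_num), cubeSubst_f (by norm_num)]
  have hd := f_one_mul_f_two
  apply twist_one_injective
  have ht (z : ℂ) (hz : z ^ 3 = 1) : twist z (f 1) * twist z (f 2) = twist 1 (f 9 * f 18) *
      (twist 1 (cubeSubst cubicFracInv) - C z * X -
        2 * (C z * X) ^ 2 * twist 1 (cubeSubst cubicFrac)) := by
    rw [← map_mul, hd, h9]
    rw [map_mul (twist z), map_sub (twist z), map_sub (twist z), map_mul (twist z),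
      map_mul (twist z), map_ofNat (twist z), map_pow (twist z), twist_X, twist_cubeSubst hz,
      twist_cubeSubst hz, twist_cubeSubst hz]
  have t0 := ht 1 (one_pow 3)
  have t1 := ht w hw
  have t2 := ht (w ^ 2) (by rw [pow_right_comm, hw, one_pow])
  have hax' := congrArg (twist 1) hax
  have z3 : (C w : ℂ⟦X⟧) ^ 3 = 1 := by rw [← map_pow, hw, map_one]
  have z2 : (C w : ℂ⟦X⟧) ^ 2 + C w + 1 = 0 := by
    rw [← map_pow, ← map_one C, ← map_add, ← map_add, hw', map_zero]
  simp only [map_mul, map_sub, map_pow, map_ofNat, twist_X, map_one, one_mul] at *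
  generalize (C w : ℂ⟦X⟧) = z at *
  generalize twist 1 (cubeSubst cubicFracInv) = a at *
  generalize twist 1 (cubeSubst cubicFrac) = x at *
  have hfac : (a - z * X - 2 * (z * X) ^ 2 * x) * (a - z ^ 2 * X - 2 * (z ^ 2 * X) ^ 2 * x) =
      a ^ 2 + X ^ 2 + 4 * X ^ 4 * x ^ 2 + a * X - 2 * X ^ 3 * x + 2 * X ^ 2 * a * x := by
    have z4 : z ^ 4 = z := by linear_combination z * z3
    have e : a - z ^ 2 * X - 2 * (z ^ 2 * X) ^ 2 * x = a - z ^ 2 * X - 2 * z * X ^ 2 * x := by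
      linear_combination (-2 * X ^ 2 * x) * z4
    rw [e]
    linear_combination (X ^ 2 + 4 * X ^ 4 * x ^ 2 + z * 2 * X ^ 3 * x) * z3 +
      (-a * X - 2 * a * X ^ 2 * x + 2 * X ^ 3 * x) * z2
  have hnorm : (a - X - 2 * X ^ 2 * x) * ((a - z * X - 2 * (z * X) ^ 2 * x) *
      (a - z ^ 2 * X - 2 * (z ^ 2 * X) ^ 2 * x)) = a ^ 3 - 7 * X ^ 3 - 8 * X ^ 6 * x ^ 3 := by
    rw [hfac]
    linear_combination (-6 * X ^ 3) * hax'
  rw [← hnorm]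
  generalize twist 1 (f 9) = p at *
  generalize twist 1 (f 18) = r at *
  calc _ = p * r * (p * r * (a - X - 2 * X ^ 2 * x)) *
        (p * r * (a - z * X - 2 * (z * X) ^ 2 * x)) *
        (p * r * (a - z ^ 2 * X - 2 * (z ^ 2 * X) ^ 2 * x)) := by ring
    _ = (twist 1 (f 1) * twist w (f 1) * twist (w ^ 2) (f 1) * p) *
        (twist 1 (f 2) * twist w (f 2) * twist (w ^ 2) (f 2) * r) := by
      rw [← t0, ← t1, ← t2]; ring
    _ = _ := by rw [h1, h2]; ring

/-- The series whose coefficients are those of index `3 n + c` in the given one. -/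
noncomputable def sect (c : ℕ) : ℤ⟦X⟧ →+ ℤ⟦X⟧ where
  toFun F := mk fun n => coeff (3 * n + c) F
  map_zero' := by ext; simp
  map_add' F G := by ext; simp

theorem coeff_sect (c n : ℕ) (F : ℤ⟦X⟧) : coeff n (sect c F) = coeff (3 * n + c) F := by
  simp [sect]

theorem X_pow_dvd_sect {c : ℕ} (hc : c < 3) {n : ℕ} {F : ℤ⟦X⟧} (h : X ^ (3 * n) ∣ F) :
    X ^ n ∣ sect c F := by
  refine X_pow_dvd_iff.mpr fun i hi => ?_
  rw [coeff_sect]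
  exact X_pow_dvd_iff.mp h _ (by omega)

theorem sect_C_mul (c : ℕ) (a : ℤ) (F : ℤ⟦X⟧) : sect c (C a * F) = C a * sect c F := by
  ext n
  rw [coeff_sect, coeff_C_mul, coeff_C_mul, coeff_sect]

theorem sect_cubeSubst_mul {c : ℕ} (hc : c < 3) (G F : ℤ⟦X⟧) :
    sect c (cubeSubst G * F) = G * sect c F := by
  ext n
  rw [coeff_sect, coeff_mul, coeff_mul]
  symm
  refine Finset.sum_of_injOn (fun p => (3 * p.1, 3 * p.2 + c)) ?_ ?_ ?_ ?_
  · rintro ⟨i, j⟩ - ⟨i', j'⟩ - h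
    simp only [Prod.mk.injEq] at h ⊢
    omega
  · rintro ⟨i, j⟩ h
    simp only [Finset.mem_coe, Finset.HasAntidiagonal.mem_antidiagonal] at h ⊢
    omega
  · rintro ⟨i, j⟩ h h'
    rw [Finset.HasAntidiagonal.mem_antidiagonal] at h
    have : ¬ 3 ∣ i := by
      rintro ⟨k, rfl⟩
      simp only at h
      refine h' ⟨(k, n - k), ?_, ?_⟩
      · simp only [Finset.mem_coe, Finset.HasAntidiagonal.mem_antidiagonal]
        omega
      · simp only [Prod.mk.injEq, true_and]
        omega
    rw [cubeSubst, coeff_expand_of_not_dvd _ _ _ this, zero_mul]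
  · rintro ⟨i, j⟩ -
    rw [cubeSubst, coeff_expand_mul, coeff_sect]

theorem sect_zero_X_mul (F : ℤ⟦X⟧) : sect 0 (X * F) = X * sect 2 F := by
  ext n
  cases n with
  | zero => simp [coeff_sect]
  | succ n =>
    rw [coeff_sect, coeff_succ_X_mul, coeff_sect, show 3 * (n + 1) + 0 = 3 * n + 2 + 1 by ring,
      coeff_succ_X_mul]

theorem sect_zero_decomposition (A B C : ℤ⟦X⟧) :
    sect 0 (cubeSubst A + cubeSubst B * X + cubeSubst C * X ^ 2) = A := by
  have h0 : sect 0 1 = 1 := by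
    ext n
    rw [coeff_sect, coeff_one, coeff_one]
    simp
  have h1 : sect 0 X = 0 := by
    ext n
    rw [coeff_sect, coeff_X, if_neg (by omega), map_zero]
  have h2 : sect 0 (X ^ 2) = 0 := by
    ext n
    rw [coeff_sect, coeff_X_pow, if_neg (by omega), map_zero]
  rw [← mul_one (cubeSubst A), map_add, map_add, sect_cubeSubst_mul (by norm_num),
    sect_cubeSubst_mul (by norm_num), sect_cubeSubst_mul (by norm_num), h0, h1, h2]
  ring

theorem cubeSubst_X : cubeSubst X = X ^ 3 := expand_X _ _

theorem cubeSubst_inv_mul : cubeSubst cubicFracInv * cubeSubst cubicFrac = 1 := by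
  rw [← map_mul, cubicFracInv_mul_cubicFrac, map_one]

theorem quot_eq : quot = cubeSubst quot ^ 3 *
    (cubeSubst cubicFracInv ^ 2 - 2 * X ^ 3 * cubeSubst cubicFrac +
      (cubeSubst cubicFracInv + 4 * X ^ 3 * cubeSubst cubicFrac ^ 2) * X + 3 * X ^ 2) := by
  have h1 := quot_mul_cubeSubst_quot_mul
  have h2 := cubicFrac_relation
  have h3 := cubeSubst_inv_mul
  generalize cubeSubst quot = T at *
  generalize cubeSubst cubicFracInv = a at *
  generalize cubeSubst cubicFrac = x at *
  linear_combination -quot * h2 + T ^ 3 * (a ^ 2 - 2 * X ^ 3 * x + (a + 4 * X ^ 3 * x ^ 2) * X +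
    3 * X ^ 2) * h1 + quot * T ^ 4 * (4 * X ^ 3 + 2 * X ^ 2 * a - 4 * X ^ 4 * x) * h3

theorem quot_cube : quot ^ 3 = 9 * cubeSubst quot ^ 3 * X ^ 2 * quot ^ 2 +
    3 * cubeSubst quot ^ 2 * X * quot + cubeSubst quot := by
  have h1 := quot_mul_cubeSubst_quot_mul
  have h2 := cubicFrac_relation
  have h3 := cubeSubst_inv_mul
  generalize cubeSubst quot = T at *
  generalize cubeSubst cubicFracInv = a at *
  generalize cubeSubst cubicFrac = x at *
  have h4 : (a - X - 2 * X ^ 2 * x) ^ 3 + 3 * X * (a - X - 2 * X ^ 2 * x) ^ 2 +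
      9 * X ^ 2 * (a - X - 2 * X ^ 2 * x) = a ^ 3 - 7 * X ^ 3 - 8 * X ^ 6 * x ^ 3 := by
    linear_combination (-6 * X ^ 2 * a + 12 * X ^ 4 * x) * h3
  rw [← h4] at h2
  generalize a - X - 2 * X ^ 2 * x = D at *
  linear_combination -quot ^ 3 * h2 + (T * ((quot * T * D) ^ 2 + quot * T * D + 1) +
    3 * X * T ^ 2 * quot * (quot * T * D + 1) + 9 * X ^ 2 * T ^ 3 * quot ^ 2) * h1

theorem sect_zero_X_mul_quot : sect 0 (X * quot) = 3 * X * quot ^ 3 := by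
  rw [← sect_zero_decomposition (3 * X * quot ^ 3)
    (quot ^ 3 * (cubicFracInv ^ 2 - 2 * X * cubicFrac))
    (quot ^ 3 * (cubicFracInv + 4 * X * cubicFrac ^ 2))]
  congr 1
  simp only [map_mul, map_pow, map_add, map_sub, map_ofNat, cubeSubst_X]
  linear_combination X * quot_eq

theorem sect_zero_X_mul_quot_sq :
    sect 0 ((X * quot) ^ 2) = 2 * X * quot ^ 2 + 27 * X ^ 2 * quot ^ 6 := by
  rw [← sect_zero_decomposition (2 * X * quot ^ 2 + 27 * X ^ 2 * quot ^ 6)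
    (quot ^ 6 * X * ((cubicFracInv + 4 * X * cubicFrac ^ 2) ^ 2 +
      6 * (cubicFracInv ^ 2 - 2 * X * cubicFrac)))
    (quot ^ 6 * ((cubicFracInv ^ 2 - 2 * X * cubicFrac) ^ 2 +
      6 * X * (cubicFracInv + 4 * X * cubicFrac ^ 2)))]
  congr 1
  simp only [map_mul, map_pow, map_add, map_sub, map_ofNat, cubeSubst_X]
  have h1 := quot_eq
  have h2 := cubicFrac_relation
  have h3 := cubeSubst_inv_mul
  generalize cubeSubst quot = T at *
  generalize cubeSubst cubicFracInv = a at *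
  generalize cubeSubst cubicFrac = x at *
  rw [mul_pow, h1]
  linear_combination (2 * X ^ 3 * T ^ 2) * h2 +
    T ^ 6 * X ^ 3 * (8 * X ^ 3 * (a * x + 1) - 4 * X ^ 3) * h3

theorem m_zero_right (i : ℕ) : m i 0 = 0 := by
  match i with
  | 0 | 1 | 2 | 3 | i + 4 => simp [m]

theorem m_add_four (i j : ℕ) :
    m (i + 4) (j + 1) = 9 * m (i + 3) j + 3 * m (i + 2) j + m (i + 1) j := by
  cases j with
  | zero => simp [m, m_zero_right]
  | succ j => rw [m]

theorem m_eq_zero_of_lt {i j : ℕ} (h : i < j) : m i j = 0 := by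
  induction i using Nat.strong_induction_on generalizing j with
  | _ i ih =>
    match i, j, h with
    | 0, j + 1, _ => simp [m]
    | 1, j + 2, _ => simp [m]
    | 2, j + 3, _ => simp [m]
    | 3, j + 4, _ => simp [m]
    | i + 4, j + 1, h =>
      rw [m_add_four, ih (i + 3) (by omega) (by omega), ih (i + 2) (by omega) (by omega),
        ih (i + 1) (by omega) (by omega)]
      simp

theorem sect_zero_pow_add_three (i : ℕ) : sect 0 ((X * quot) ^ (i + 3)) =
    9 * X * quot ^ 3 * sect 0 ((X * quot) ^ (i + 2)) +
      3 * X * quot ^ 2 * sect 0 ((X * quot) ^ (i + 1)) + X * quot * sect 0 ((X * quot) ^ i) := by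
  have e : (X * quot) ^ (i + 3) = cubeSubst (9 * X * quot ^ 3) * (X * quot) ^ (i + 2) +
      cubeSubst (3 * X * quot ^ 2) * (X * quot) ^ (i + 1) +
      cubeSubst (X * quot) * (X * quot) ^ i := by
    simp only [map_mul, map_pow, map_ofNat, cubeSubst_X]
    linear_combination (X * quot) ^ i * X ^ 3 * quot_cube
  rw [e, map_add, map_add, sect_cubeSubst_mul (by norm_num), sect_cubeSubst_mul (by norm_num),
    sect_cubeSubst_mul (by norm_num)]

theorem sect_zero_pow_mul (i N : ℕ) (h : i + 1 ≤ N) :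
    sect 0 ((X * quot) ^ (i + 1)) * quot ^ (i + 1) =
      ∑ j ∈ Finset.range (N + 1), C (m (i + 1) j) * (X * quot ^ 4) ^ j := by
  have h1 : sect 0 ((X * quot) ^ 1) = 3 * X * quot ^ 3 := by rw [pow_one, sect_zero_X_mul_quot]
  have h2 := sect_zero_X_mul_quot_sq
  have small (M n : ℕ) (hn : n ≤ M) :
      ∑ j ∈ Finset.range (M + 1), C (m n j) * (X * quot ^ 4) ^ j =
        ∑ j ∈ Finset.range (n + 1), C (m n j) * (X * quot ^ 4) ^ j := by
    symm
    refine Finset.sum_subset (Finset.range_mono (by omega)) fun j _ hj => ?_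
    rw [m_eq_zero_of_lt (by rw [Finset.mem_range] at hj; omega), map_zero, zero_mul]
  induction i using Nat.strong_induction_on generalizing N with
  | _ i ih =>
    match i with
    | 0 =>
      rw [small N 1 h, zero_add, h1]
      simp only [Finset.sum_range_succ, Finset.sum_range_zero, m, map_ofNat, map_zero]
      ring
    | 1 =>
      rw [small N 2 h, h2]
      simp only [Finset.sum_range_succ, Finset.sum_range_zero, m, map_ofNat, map_zero, map_pow]
      ring
    | 2 =>
      rw [small N 3 h, sect_zero_pow_add_three 0, h1, h2, pow_zero]
      have h0 : sect 0 1 = 1 := by simpa using sect_zero_decomposition 1 0 0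
      rw [h0]
      simp only [Finset.sum_range_succ, Finset.sum_range_zero, m, map_ofNat, map_zero, map_pow,
        map_one]
      ring
    | i + 3 =>
      obtain ⟨N, rfl⟩ : ∃ n, N = n + 1 := ⟨N - 1, by omega⟩
      have e1 := ih (i + 2) (by omega) N (by omega)
      have e2 := ih (i + 1) (by omega) N (by omega)
      have e3 := ih i (by omega) N (by omega)
      rw [Finset.sum_range_succ', m_zero_right, map_zero, zero_mul, add_zero]
      have e : ∑ j ∈ Finset.range (N + 1), C (m (i + 3 + 1) (j + 1)) * (X * quot ^ 4) ^ (j + 1) =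
          X * quot ^ 4 * (9 * ∑ j ∈ Finset.range (N + 1), C (m (i + 3) j) * (X * quot ^ 4) ^ j +
            3 * ∑ j ∈ Finset.range (N + 1), C (m (i + 2) j) * (X * quot ^ 4) ^ j +
            ∑ j ∈ Finset.range (N + 1), C (m (i + 1) j) * (X * quot ^ 4) ^ j) := by
        rw [Finset.mul_sum, Finset.mul_sum, ← Finset.sum_add_distrib, ← Finset.sum_add_distrib,
          Finset.mul_sum]
        refine Finset.sum_congr rfl fun j _ => ?_
        rw [m_add_four, map_add, map_add, map_mul, map_mul, map_ofNat, map_ofNat]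
        ring
      rw [e, ← e1, ← e2, ← e3, sect_zero_pow_add_three (i + 1)]
      ring

theorem quot_ne_zero : quot ≠ 0 := fun h => by
  have := quot_mul
  rw [h, zero_mul] at this
  exact mul_ne_zero (f_ne_zero (by norm_num)) (f_ne_zero (by norm_num)) this.symm

theorem sect_zero_pow_eq_shift (i k M : ℕ) (h : i + 1 ≤ M) (hk : 3 * k < i + 1) :
    sect 0 ((X * quot) ^ (i + 1)) * quot ^ (i + 1) = (X * quot ^ 4) ^ (k + 1) *
      ∑ j ∈ Finset.range M, C (m (i + 1) (k + 1 + j)) * (X * quot ^ 4) ^ j := by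
  rw [sect_zero_pow_mul i (k + M) (by omega), show k + M + 1 = k + 1 + M by ring,
    Finset.sum_range_add, Finset.sum_eq_zero, zero_add, Finset.mul_sum]
  · exact Finset.sum_congr rfl fun j _ => by ring
  · intro j hj
    rw [m_eq_zero _ _ (by rw [Finset.mem_range] at hj; omega), map_zero, zero_mul]

theorem sect_two_term (k M : ℕ) (h : 4 * k + 1 ≤ M) : sect 2 (X ^ k * quot ^ (4 * k + 1)) =
    ∑ j ∈ Finset.range M, C (m (4 * k + 1) (k + 1 + j)) * X ^ j * quot ^ (4 * j + 3) := by
  have key := sect_zero_pow_eq_shift (4 * k) k M h (by omega)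
  have e : (X * quot) ^ (4 * k + 1) = cubeSubst (X ^ k) * (X * (X ^ k * quot ^ (4 * k + 1))) := by
    rw [map_pow, cubeSubst_X]; ring
  rw [e, sect_cubeSubst_mul (by norm_num), sect_zero_X_mul] at key
  refine mul_left_cancel₀ (mul_ne_zero (pow_ne_zero (k + 1) X_ne_zero)
    (pow_ne_zero (4 * k + 1) quot_ne_zero)) ?_
  refine Eq.trans (by ring) (key.trans ?_)
  rw [Finset.mul_sum, Finset.mul_sum]
  exact Finset.sum_congr rfl fun j _ => by ring

theorem sect_zero_term (k M : ℕ) (h : 4 * k + 3 ≤ M) : sect 0 (X ^ k * quot ^ (4 * k + 3)) =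
    ∑ j ∈ Finset.range M, C (m (4 * k + 3) (k + 1 + j)) * X ^ j * quot ^ (4 * j + 1) := by
  have key := sect_zero_pow_eq_shift (4 * k + 2) k M h (by omega)
  have e : (X * quot) ^ (4 * k + 3) = cubeSubst (X ^ (k + 1)) * (X ^ k * quot ^ (4 * k + 3)) := by
    rw [map_pow, cubeSubst_X]; ring
  rw [e, sect_cubeSubst_mul (by norm_num)] at key
  refine mul_left_cancel₀ (mul_ne_zero (pow_ne_zero (k + 1) X_ne_zero)
    (pow_ne_zero (4 * k + 3) quot_ne_zero)) ?_
  refine Eq.trans (by ring) (key.trans ?_)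
  rw [Finset.mul_sum, Finset.mul_sum]
  exact Finset.sum_congr rfl fun j _ => by ring

theorem X_pow_dvd_sum_sub_of_hasSum {ι : Type*} {t : ι → ℤ⟦X⟧} {L : ℤ⟦X⟧} (h : HasSum t L)
    {s : Finset ι} {n : ℕ} (hs : ∀ i ∉ s, X ^ n ∣ t i) : X ^ n ∣ ∑ i ∈ s, t i - L := by
  refine X_pow_dvd_iff.mpr fun d hd => ?_
  rw [map_sub, map_sum, sub_eq_zero]
  exact (hasSum_sum_of_ne_finset_zero fun i hi => X_pow_dvd_iff.mp (hs i hi) d hd).unique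
    ((WithPiTopology.hasSum_iff_hasSum_coeff ℤ).mp h d)

theorem hasSum_rowMul {v : ℕ+ → ℤ} {M : Matrix ℕ+ ℕ+ ℤ} {F : ℤ⟦X⟧} {e e' : ℕ+ → ℤ⟦X⟧} {c : ℕ}
    (hc : c < 3) (he : ∀ i : ℕ+, X ^ ((i : ℕ) - 1) ∣ e i) (he' : ∀ i : ℕ+, X ^ ((i : ℕ) - 1) ∣ e' i)
    (hM : ∀ i j : ℕ+, 3 * (j : ℕ) < i → M i j = 0)
    (hsect : ∀ i, HasSum (fun j => C (M i j) * e' j) (sect c (e i)))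
    (hF : HasSum (fun i => C (v i) * e i) F) :
    HasSum (fun j => C (rowMul v M j) * e' j) (sect c F) := by
  have tail {u : ℕ+ → ℤ⟦X⟧} (hu : ∀ i : ℕ+, X ^ ((i : ℕ) - 1) ∣ u i) (w : ℕ+ → ℤ) (d : ℕ) (i : ℕ+)
      (hi : i ∉ Finset.Icc 1 d.succPNat) : X ^ (d + 1) ∣ C (w i) * u i := by
    have : d + 1 < (i : ℕ) := by
      rw [Finset.mem_Icc, not_and, not_le] at hi
      exact hi one_le
    exact ((pow_dvd_pow X (by omega)).trans (hu i)).mul_left _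
  refine hasSum_of_dvd (fun d => Finset.Icc 1 d.succPNat) (fun d j => tail he' _ d j) fun d => ?_
  have h1 := X_pow_dvd_sum_sub_of_hasSum hF (tail he v (3 * (d + 1)))
  have h2 := X_pow_dvd_sect hc ((pow_dvd_pow X (Nat.le_succ (3 * (d + 1)))).trans h1)
  have h3 (i : ℕ+) := X_pow_dvd_sum_sub_of_hasSum (hsect i) (tail he' (M i) d)
  have h4 := Finset.dvd_sum fun i (_ : i ∈ Finset.Icc 1 (3 * (d + 1)).succPNat) =>
    (h3 i).mul_left (C (v i))
  have h5 : ∑ j ∈ Finset.Icc 1 d.succPNat, C (rowMul v M j) * e' j =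
      ∑ i ∈ Finset.Icc 1 (3 * (d + 1)).succPNat,
        C (v i) * ∑ j ∈ Finset.Icc 1 d.succPNat, C (M i j) * e' j := by
    simp_rw [Finset.mul_sum]
    rw [Finset.sum_comm]
    refine Finset.sum_congr rfl fun j hj => ?_
    rw [rowMul, finsum_eq_sum_of_support_subset (s := Finset.Icc 1 (3 * (d + 1)).succPNat),
      map_sum, Finset.sum_mul]
    · exact Finset.sum_congr rfl fun i _ => by rw [map_mul, mul_assoc]
    · intro i hi
      rw [Finset.coe_Icc, Set.mem_Icc]
      refine ⟨one_le, ?_⟩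
      by_contra hlt
      refine hi ?_
      rw [not_le] at hlt
      have hlt' : 3 * (d + 1) + 1 < (i : ℕ) := hlt
      have hj' : (j : ℕ) ≤ d + 1 := (Finset.mem_Icc.mp hj).2
      change v i * M i j = 0
      rw [hM i j (by omega), mul_zero]
  rw [map_sub, map_sum] at h2
  simp_rw [sect_C_mul] at h2
  simp_rw [mul_sub, Finset.sum_sub_distrib] at h4
  rw [h5]
  convert h4.add h2 using 1
  ring

theorem hasSum_pnat {t : ℕ+ → ℤ⟦X⟧} {N : ℕ} (h : ∀ k : ℕ, N ≤ k → t k.succPNat = 0) :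
    HasSum t (∑ k ∈ Finset.range N, t k.succPNat) := by
  refine (Equiv.pnatEquivNat.symm.hasSum_iff).mp ?_
  refine hasSum_sum_of_ne_finset_zero (f := t ∘ Equiv.pnatEquivNat.symm) fun k hk => ?_
  rw [Finset.mem_range, not_lt] at hk
  exact h k hk

theorem hasSum_sect_two (i : ℕ+) :
    HasSum (fun j : ℕ+ => C (A i j) * (X ^ ((j : ℕ) - 1) * quot ^ (4 * (j : ℕ) - 1)))
      (sect 2 (X ^ ((i : ℕ) - 1) * quot ^ (4 * (i : ℕ) - 3))) := by
  obtain ⟨k, rfl⟩ : ∃ k : ℕ, i = k.succPNat := ⟨i.natPred, (PNat.succPNat_natPred i).symm⟩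
  have e : (k.succPNat : ℕ) = k + 1 := rfl
  rw [e, Nat.add_sub_cancel, show 4 * (k + 1) - 3 = 4 * k + 1 by omega, sect_two_term k _ le_rfl]
  have hA (j : ℕ) : A k.succPNat j.succPNat = m (4 * k + 1) (k + 1 + j) := by
    simp only [A, Matrix.of_apply, Nat.succPNat_coe]
    congr 1
  convert hasSum_pnat (N := 4 * k + 1) ?_ using 1
  · refine Finset.sum_congr rfl fun j _ => ?_
    rw [hA, Nat.succPNat_coe, Nat.succ_sub_one, mul_assoc]
    rfl
  · intro j hj
    rw [hA, m_eq_zero_of_lt (by omega), map_zero, zero_mul]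

theorem hasSum_sect_zero (i : ℕ+) :
    HasSum (fun j : ℕ+ => C (B i j) * (X ^ ((j : ℕ) - 1) * quot ^ (4 * (j : ℕ) - 3)))
      (sect 0 (X ^ ((i : ℕ) - 1) * quot ^ (4 * (i : ℕ) - 1))) := by
  obtain ⟨k, rfl⟩ : ∃ k : ℕ, i = k.succPNat := ⟨i.natPred, (PNat.succPNat_natPred i).symm⟩
  have e : (k.succPNat : ℕ) = k + 1 := rfl
  rw [e, Nat.add_sub_cancel, show 4 * (k + 1) - 1 = 4 * k + 3 by omega, sect_zero_term k _ le_rfl]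
  have hB (j : ℕ) : B k.succPNat j.succPNat = m (4 * k + 3) (k + 1 + j) := by
    simp only [B, Matrix.of_apply, Nat.succPNat_coe]
    congr 1
  convert hasSum_pnat (N := 4 * k + 3) ?_ using 1
  · refine Finset.sum_congr rfl fun j _ => ?_
    rw [hB, Nat.succPNat_coe, Nat.succ_sub_one, mul_assoc]
    rfl
  · intro j hj
    rw [hB, m_eq_zero_of_lt (by omega), map_zero, zero_mul]

theorem A_eq_zero (i j : ℕ+) (h : 3 * (j : ℕ) < i) : A i j = 0 :=
  m_eq_zero _ _ (by have := j.pos; omega)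

theorem B_eq_zero (i j : ℕ+) (h : 3 * (j : ℕ) < i) : B i j = 0 :=
  m_eq_zero _ _ (by have := j.pos; omega)

theorem hasSum_step_A {v : ℕ+ → ℤ} {F : ℤ⟦X⟧}
    (h : HasSum (fun i : ℕ+ => C (v i) * X ^ ((i : ℕ) - 1) * quot ^ (4 * (i : ℕ) - 3)) F) :
    HasSum (fun i : ℕ+ => C (rowMul v A i) * X ^ ((i : ℕ) - 1) * quot ^ (4 * (i : ℕ) - 1))
      (sect 2 F) := by
  simp_rw [mul_assoc] at h ⊢
  exact hasSum_rowMul (by norm_num) (fun _ => dvd_mul_right _ _) (fun _ => dvd_mul_right _ _)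
    A_eq_zero hasSum_sect_two h

theorem hasSum_step_B {v : ℕ+ → ℤ} {F : ℤ⟦X⟧}
    (h : HasSum (fun i : ℕ+ => C (v i) * X ^ ((i : ℕ) - 1) * quot ^ (4 * (i : ℕ) - 1)) F) :
    HasSum (fun i : ℕ+ => C (rowMul v B i) * X ^ ((i : ℕ) - 1) * quot ^ (4 * (i : ℕ) - 3))
      (sect 0 F) := by
  simp_rw [mul_assoc] at h ⊢
  exact hasSum_rowMul (by norm_num) (fun _ => dvd_mul_right _ _) (fun _ => dvd_mul_right _ _)
    B_eq_zero hasSum_sect_zero h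

theorem pow_two_mul_mod_four (α : ℕ) : 3 ^ (2 * α) % 4 = 1 := by
  rw [pow_mul, Nat.pow_mod]
  norm_num

theorem sect_two_progression (α : ℕ) :
    sect 2 (mk fun n => a₃ (3 ^ (2 * α) * n + (3 ^ (2 * α) - 1) / 4)) =
      mk fun n => a₃ (3 ^ (2 * α + 1) * n + (3 ^ (2 * α + 2) - 1) / 4) := by
  ext n
  rw [coeff_sect, coeff_mk, coeff_mk, pow_succ, pow_add]
  have h := pow_two_mul_mod_four α
  congr 1
  generalize 3 ^ (2 * α) = p at *
  have e : (p * 3 ^ 2 - 1) / 4 = p * 2 + (p - 1) / 4 := by omega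
  rw [e]
  ring

theorem sect_zero_progression (α : ℕ) :
    sect 0 (mk fun n => a₃ (3 ^ (2 * α + 1) * n + (3 ^ (2 * α + 2) - 1) / 4)) =
      mk fun n => a₃ (3 ^ (2 * (α + 1)) * n + (3 ^ (2 * (α + 1)) - 1) / 4) := by
  ext n
  rw [coeff_sect, coeff_mk, coeff_mk]
  congr 1
  ring_nf

theorem x_odd (α : ℕ) : x (2 * α + 1) = rowMul (x (2 * α)) A := by
  rw [x, if_pos (even_two_mul α)]

theorem x_even (α : ℕ) : x (2 * (α + 1)) = rowMul (x (2 * α + 1)) B := by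
  rw [show 2 * (α + 1) = 2 * α + 1 + 1 by ring, x, if_neg]
  exact Nat.not_even_two_mul_add_one α

theorem hasSum_even (α : ℕ) :
    HasSum (fun i : ℕ+ => C (x (2 * α) i) * X ^ ((i : ℕ) - 1) * quot ^ (4 * (i : ℕ) - 3))
      (mk fun n : ℕ => a₃ (3 ^ (2 * α) * n + (3 ^ (2 * α) - 1) / 4)) := by
  induction α with
  | zero =>
    have h : (mk fun n : ℕ => a₃ (3 ^ (2 * 0) * n + (3 ^ (2 * 0) - 1) / 4)) = quot := by
      ext n
      simp [a₃]
    rw [h]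
    convert hasSum_single (1 : ℕ+) ?_ using 1
    · simp [x]
    · intro i hi
      simp [x, hi]
  | succ α ih =>
    rw [← sect_zero_progression, ← sect_two_progression, x_even, x_odd]
    exact hasSum_step_B (hasSum_step_A ih)

theorem hasSum_odd (α : ℕ) :
    HasSum (fun i : ℕ+ => C (x (2 * α + 1) i) * X ^ ((i : ℕ) - 1) * quot ^ (4 * (i : ℕ) - 1))
      (mk fun n : ℕ => a₃ (3 ^ (2 * α + 1) * n + (3 ^ (2 * α + 2) - 1) / 4)) := by
  rw [← sect_two_progression, x_odd]
  exact hasSum_step_A (hasSum_even α)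

end CubicPartition

theorem mainTheorem3 (α : ℕ) :
    HasSum
      (fun i : ℕ+ => C (CubicPartition.x (2 * α) i) * X ^ ((i : ℕ) - 1) *
        CubicPartition.quot ^ (4 * (i : ℕ) - 3))
      (PowerSeries.mk fun n : ℕ =>
        CubicPartition.a₃ (3 ^ (2 * α) * n + (3 ^ (2 * α) - 1) / 4)) ∧
    HasSum
      (fun i : ℕ+ => C (CubicPartition.x (2 * α + 1) i) * X ^ ((i : ℕ) - 1) *
        CubicPartition.quot ^ (4 * (i : ℕ) - 1))
      (PowerSeries.mk fun n : ℕ =>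
        CubicPartition.a₃ (3 ^ (2 * α + 1) * n + (3 ^ (2 * α + 2) - 1) / 4)) :=
  ⟨CubicPartition.hasSum_even α, CubicPartition.hasSum_odd α⟩
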